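/- Let $\tau\in\mathbb{C}$ with $\operatorname{Im}\tau>0$, let $q=e^{\pi i\tau}$, and for complex $s$ put $q^{s}=e^{\pi i\tau s}$ and $\log q=\pi i\tau$; a function of $q^n$ is the corresponding function of $q$ with $\tau$ replaced by $n\tau$. Let $(b;q)_\infty=\prod_{i\ge 0}(1-bq^i)$ and $$\Gamma_q(z)=\frac{(q;q)_\infty}{(q^z;q)_\infty}(1-q)^{1-z}$$ (principal power of $1-q$). Gosper's $q$-sine is defined by $$\sin_q(\pi w)=q^{1/4}\,\Gamma_{q^2}\!\left(\tfrac12\right)^2\frac{q^{w(w-1)}}{\Gamma_{q^2}(w)\,\Gamma_{q^2}(1-w)}\qquad(w\in\mathbb{C}),$$ where $1/\Gamma_{q^2}$ is read as $0$ at the poles of $\Gamma_{q^2}$. Put $\mathrm{Ct}_q(z)=\sin_q'(z)/\sin_q(z)$, where the prime denotes $d/dz$, and $$\Pi_q=q^{1/4}\frac{(q^2;q^2)_\infty^2}{(q;q^2)_\infty^2},\qquad \Pi_q^{1/2}=q^{1/8}\frac{(q^2;q^2)_\infty}{(q;q^2)_\infty},\qquad \Pi_q^{3/2}=\bigl(\Pi_q^{1/2}\bigr)^3$$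 (for $0<q<1$, that is, for purely imaginary $\tau$, these are the usual positive powers of $\Pi_q>0$). Let $a$ be an odd integer. Then: (a) $\sin_{q^2}$ is differentiable and nonzero at $\frac{a\pi}{4}$, and $$\mathrm{Ct}_{q^2}\!\left(\frac{a\pi}{4}\right)=\begin{cases}-\dfrac{\log q}{\pi}\,\dfrac{\Pi_q^2}{\Pi_{q^2}} & \text{if } a\equiv 1,-3 \pmod 8,\\[2mm] \dfrac{\log q}{\pi}\,\dfrac{\Pi_q^2}{\Pi_{q^2}} & \text{if } a\equiv -1,3 \pmod 8.\end{cases}$$ (b) $\sin_{q^3}$ is differentiable and nonzero at $\frac{a\pi}{6}$, and $$\mathrm{Ct}_{q^3}\!\left(\frac{a\pi}{6}\right)=\begin{cases}-\dfrac{2\log q}{\pi}\,\dfrac{\Pi_q^{3/2}}{\Pi_{q^3}^{1/2}} & \text{if } a\equiv 1,-5 \pmod{12},\\[2mm] \dfrac{2\log q}{\pi}\,\dfrac{\Pi_q^{3/2}}{\Pi_{q^3}^{1/2}} & \text{if } a\equiv -1,5 \pmod{12},\\[2mm] 0 & \text{if } a\equiv 3,-3 \pmod{12}.\end{cases}$$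 -/

import Mathlib

namespace GosperTrig

noncomputable section

/-- For `τ` in the upper half plane and `q = exp (π i τ)`, the power `q ^ s = exp (π i τ s)`.
All functions of `q` below are indexed by `τ`; replacing `q` by `q ^ n` means replacing `τ`
by `n * τ`. -/
def qPow (τ s : ℂ) : ℂ := Complex.exp (Real.pi * Complex.I * τ * s)

/-- `log q = π i τ`. -/
def logQ (τ : ℂ) : ℂ := Real.pi * Complex.I * τ

/-- The infinite `q`-shifted factorial `(a; q)_∞ = ∏_{i ≥ 0} (1 - a q ^ i)`. -/
def qShifted (a q : ℂ) : ℂ := ∏' i : ℕ, (1 - a * q ^ i)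

/-- The `q`-gamma function
`Γ_q(z) = (q; q)_∞ / (q ^ z; q)_∞ * (1 - q) ^ (1 - z)`, with `q = exp (π i τ)`.
At a pole of `Γ_q` this definition gives `0`, so that `1 / Γ_q` vanishes there, as it should. -/
def qGamma (τ z : ℂ) : ℂ :=
  qShifted (qPow τ 1) (qPow τ 1) / qShifted (qPow τ z) (qPow τ 1) * (1 - qPow τ 1) ^ (1 - z)

/-- Gosper's `q`-sine, given by
`sin_q (π w) = q ^ (1/4) Γ_{q²}(1/2)² q ^ (w (w - 1)) / (Γ_{q²}(w) Γ_{q²}(1 - w))`,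
evaluated at `z = π w`. -/
def sinQ (τ z : ℂ) : ℂ :=
  qPow τ (1 / 4) * qGamma (2 * τ) (1 / 2) ^ 2 *
    (qPow τ (z / Real.pi * (z / Real.pi - 1)) /
      (qGamma (2 * τ) (z / Real.pi) * qGamma (2 * τ) (1 - z / Real.pi)))

/-- The `q`-cotangent `Ct_q(z) = sin_q' z / sin_q z`. -/
def cotQ (τ z : ℂ) : ℂ := deriv (sinQ τ) z / sinQ τ z

/-- Gosper's constant `Π_q = q ^ (1/4) (q²; q²)_∞² / (q; q²)_∞²`. -/
def gosperPi (τ : ℂ) : ℂ :=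
  qPow τ (1 / 4) * qShifted (qPow τ 2) (qPow τ 2) ^ 2 / qShifted (qPow τ 1) (qPow τ 2) ^ 2

/-- The square root `Π_q ^ (1/2) = q ^ (1/8) (q²; q²)_∞ / (q; q²)_∞`: the branch that is
holomorphic in `τ` on the upper half plane and positive for `0 < q < 1`. -/
def gosperPiSqrt (τ : ℂ) : ℂ :=
  qPow τ (1 / 8) * qShifted (qPow τ 2) (qPow τ 2) / qShifted (qPow τ 1) (qPow τ 2)

theorem gosperPiSqrt_sq (τ : ℂ) : gosperPiSqrt τ ^ 2 = gosperPi τ := by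
  have h : qPow τ (1 / 8) ^ 2 = qPow τ (1 / 4) := by
    rw [qPow, qPow, ← Complex.exp_nat_mul]
    congr 1
    push_cast
    ring
  rw [gosperPiSqrt, gosperPi, div_pow, mul_pow, h]

theorem qShifted_pos {x y : ℝ} (hx0 : 0 < x) (hx : x < 1) (hy0 : 0 < y) (hy : y < 1) :
    ∃ r : ℝ, 0 < r ∧ qShifted x y = r := by
  have hs : Summable fun i : ℕ => ‖-(x * y ^ i)‖ := by
    simp only [norm_neg]
    exact ((summable_geometric_of_lt_one hy0.le hy).mul_left x).norm
  have hpos : ∀ i : ℕ, 0 < 1 - x * y ^ i := fun i => by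
    have h1 : y ^ i ≤ 1 := pow_le_one₀ hy0.le hy.le
    nlinarith [pow_pos hy0 i]
  refine ⟨∏' i : ℕ, (1 - x * y ^ i), ?_, ?_⟩
  · refine lt_of_le_of_ne ?_ ?_
    · by_cases hm : Multipliable fun i : ℕ => 1 - x * y ^ i
      · exact ge_of_tendsto' hm.hasProd fun s => Finset.prod_nonneg fun i _ => (hpos i).le
      · rw [tprod_eq_one_of_not_multipliable hm]
        exact zero_le_one
    · have := tprod_one_add_ne_zero_of_summable (f := fun i : ℕ => -(x * y ^ i))
        (fun i => by have := hpos i; simp only [← sub_eq_add_neg]; exact this.ne') hs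
      simpa only [← sub_eq_add_neg] using this.symm
  · have hm : Multipliable fun i : ℕ => 1 - x * y ^ i := by
      simpa only [← sub_eq_add_neg] using
        multipliable_one_add_of_summable (f := fun i : ℕ => -(x * y ^ i)) hs
    have h := hm.map_tprod Complex.ofRealHom Complex.continuous_ofReal
    simp only [Complex.ofRealHom_eq_coe] at h
    rw [qShifted, h]
    push_cast
    rfl

/-- For `0 < q = exp (-π t) < 1` the chosen square root of `Π_q` is the positive one. -/
theorem gosperPiSqrt_pos {t : ℝ} (ht : 0 < t) :
    ∃ r : ℝ, 0 < r ∧ gosperPiSqrt (Complex.I * t) = r := by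
  have hq : ∀ s : ℝ, qPow (Complex.I * t) s = (Real.exp (-(Real.pi * t * s)) : ℝ) := fun s => by
    rw [qPow, Complex.ofReal_exp]
    congr 1
    push_cast
    linear_combination (Real.pi * t * s : ℂ) * Complex.I_mul_I
  have hlt : ∀ s : ℝ, 0 < s → Real.exp (-(Real.pi * t * s)) < 1 := fun s hs => by
    rw [Real.exp_lt_one_iff]
    have := mul_pos (mul_pos Real.pi_pos ht) hs
    linarith
  obtain ⟨A, hA, hA'⟩ := qShifted_pos (Real.exp_pos _) (hlt 2 two_pos) (Real.exp_pos _)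
    (hlt 2 two_pos)
  obtain ⟨B, hB, hB'⟩ := qShifted_pos (Real.exp_pos _) (hlt 1 one_pos) (Real.exp_pos _)
    (hlt 2 two_pos)
  have h8 := hq (1 / 8)
  have h2 := hq 2
  have h1 := hq 1
  push_cast at h8 h2 h1
  refine ⟨Real.exp (-(Real.pi * t * (1 / 8))) * A / B,
    div_pos (mul_pos (Real.exp_pos _) hA) hB, ?_⟩
  rw [gosperPiSqrt, h8, h2, h1]
  push_cast at hA' hB' ⊢
  rw [hA', hB']

end

end GosperTrig

/-!
Write `w = z / π`, `Q = q²` and `x = q^{2w}`. The powers of `1 - q²` in the `q`-gamma functions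
cancel (`sinQ_eq`), so that
`sin_q(π w) = q^{(w - 1/2)²} (x; Q)_∞ (Q/x; Q)_∞ / (q; Q)_∞²`.
Hence `sin_q` is entire, antiperiodic with antiperiod `π`, and odd, and its logarithmic derivative
has period `π` and is odd. This reduces the claim to the arguments `π/4`, `π/6`, `π/2`, and at `π/2`
the symmetries alone give `0`. For `0 < w < 1` the logarithmic derivative of the product, with every
term expanded as a geometric series and the two summations exchanged, is a Lambert series
(`cotQ_eq_lambert`):
`Ct_q(π w) = (log q / π) (2w - 1 + 2 ∑_{m ≥ 1} ((Q/x)^m - x^m) / (1 - Q^m))`.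

It remains to evaluate the Lambert series with `(w, q)` replaced by `(1/4, q²)` and `(1/6, q³)`.
Both follow from the bilateral sum (`tsum_zpow_div_one_sub`), valid for `0 < |Q| < |x| < 1` when
`y ≠ 0` is not an integral power of `Q`,
`∑_{n ∈ ℤ} x^n / (1 - y Q^n) =
  (Q; Q)_∞² (xy; Q)_∞ (Q/(xy); Q)_∞ / ((x; Q)_∞ (Q/x; Q)_∞ (y; Q)_∞ (Q/y; Q)_∞)`
at `x = q`, `Q = q²` and `y = -1`, respectively `y` a primitive cube root of unity: pairing the
terms `n` and `-n` turns the left side into the Lambert series, and `1 - a² = (1 - a)(1 + a)`,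
respectively `1 - a³ = (1 - a)(1 - ya)(1 - y²a)`, turns the right side into the quotient of the
constants `Π`.

The bilateral sum is the limit of a finite identity (`qShiftedFin_symm_partial_fractions`): the
partial fraction expansion of `∏_{k < 2N} (t - x Q^k) / ∏_{k ≤ 2N} (t - Q^k)` at `t = Q^N / y`,
obtained from Lagrange interpolation. Its terms are dominated by a multiple of
`|x^n / (1 - y Q^n)|`, so that Tannery's theorem applies.
-/

namespace GosperTrig

open Filter Topology

/-! ### Partial fractions of finite q-products -/

/-- The finite `q`-shifted factorial `(a; q)_n = ∏_{i < n} (1 - a q ^ i)`. -/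
def qShiftedFin (a q : ℂ) (n : ℕ) : ℂ := ∏ i ∈ Finset.range n, (1 - a * q ^ i)

theorem prod_range_const_mul (c : ℂ) (f : ℕ → ℂ) (n : ℕ) :
    ∏ k ∈ Finset.range n, c * f k = c ^ n * ∏ k ∈ Finset.range n, f k := by
  rw [Finset.prod_mul_distrib, Finset.prod_const, Finset.card_range]

/-- Lagrange interpolation of `∏_{k < M} (t - x Q ^ k)`, of degree `M`, at the `M + 1` nodes
`Q ^ m`. The powers of `Q` and the signs in the numerator and the denominator of each coefficient
cancel. -/
theorem lagrange_partial_fractions {Q : ℂ} (hQ0 : Q ≠ 0) (hQ : ∀ j : ℕ, Q ^ (j + 1) ≠ 1)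
    (x t : ℂ) (M : ℕ) (ht : ∀ k ∈ Finset.range (M + 1), t ≠ Q ^ k) :
    (∏ k ∈ Finset.range M, (t - x * Q ^ k)) / ∏ k ∈ Finset.range (M + 1), (t - Q ^ k) =
      ∑ m ∈ Finset.range (M + 1),
        (∏ j ∈ Finset.range m, (x - Q ^ (j + 1)) / (1 - Q ^ (j + 1))) *
          (qShiftedFin x Q (M - m) / qShiftedFin Q Q (M - m)) / (t - Q ^ m) := by
  have hpow : ∀ i d : ℕ, Q ^ i ≠ Q ^ (i + d + 1) := fun i d h => by
    rw [add_assoc, pow_add] at h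
    exact hQ d (mul_left_cancel₀ (pow_ne_zero i hQ0) (by rw [mul_one, ← h]))
  have hinj : Set.InjOn (fun k : ℕ => Q ^ k) (Finset.range (M + 1)) := by
    intro i _ j _ h
    rcases lt_trichotomy i j with hij | hij | hij
    · obtain ⟨d, rfl⟩ := Nat.exists_eq_add_of_lt hij
      exact absurd h (hpow i d)
    · exact hij
    · obtain ⟨d, rfl⟩ := Nat.exists_eq_add_of_lt hij
      exact absurd h.symm (hpow j d)
  have hnodal : ∏ k ∈ Finset.range (M + 1), (t - Q ^ k) ≠ 0 :=
    Finset.prod_ne_zero_iff.mpr fun k hk => sub_ne_zero.mpr (ht k hk)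
  set f : Polynomial ℂ :=
    ∏ k ∈ Finset.range M, (Polynomial.X - Polynomial.C (x * Q ^ k)) with hf
  have hdeg : f.degree < (Finset.range (M + 1)).card := by
    rw [hf, Polynomial.degree_prod]
    simp only [Polynomial.degree_X_sub_C, Finset.sum_const, Finset.card_range, nsmul_eq_mul,
      mul_one]
    exact_mod_cast Nat.lt_succ_self M
  have hev : ∀ s : ℂ, f.eval s = ∏ k ∈ Finset.range M, (s - x * Q ^ k) := fun s => by
    rw [hf, Polynomial.eval_prod]
    simp
  have h := congrArg (Polynomial.eval t) (Lagrange.eq_interpolate hinj hdeg)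
  rw [Lagrange.eval_interpolate_not_at_node _ ht, Lagrange.eval_nodal, hev] at h
  rw [h, mul_div_cancel_left₀ _ hnodal]
  refine Finset.sum_congr rfl fun m hm => ?_
  obtain ⟨d, rfl⟩ := Nat.exists_eq_add_of_le (Nat.lt_succ_iff.mp (Finset.mem_range.mp hm))
  rw [mul_right_comm, div_eq_mul_inv _ (t - Q ^ m)]
  congr 1
  rw [hev, Lagrange.nodalWeight, Finset.prod_inv_distrib, Nat.add_sub_cancel_left]
  -- The factors with `k < m` and those with `k > m` are treated separately.
  have hsplit : (Finset.range (m + d + 1)).erase m =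
      (Finset.range m) ∪ (Finset.range d).image (fun i => m + 1 + i) := by
    ext i
    simp only [Finset.mem_erase, Finset.mem_range, Finset.mem_union, Finset.mem_image]
    constructor
    · rintro ⟨h1, h2⟩
      rcases Nat.lt_or_ge i m with h3 | h3
      · exact Or.inl h3
      · exact Or.inr ⟨i - (m + 1), by omega, by omega⟩
    · rintro (h1 | ⟨j, h1, rfl⟩) <;> omega
  have hdisj : Disjoint (Finset.range m) ((Finset.range d).image (fun i => m + 1 + i)) := by
    rw [Finset.disjoint_left]
    intro i hi hi'
    simp only [Finset.mem_range, Finset.mem_image] at hi hi'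
    omega
  rw [hsplit, Finset.prod_union hdisj, Finset.prod_image (by intro i _ j _ h; simpa using h),
    Finset.prod_range_add]
  have e1 : ∏ k ∈ Finset.range m, (Q ^ m - x * Q ^ k) =
      (∏ k ∈ Finset.range m, Q ^ k) * (-1) ^ m * ∏ j ∈ Finset.range m, (x - Q ^ (j + 1)) := by
    rw [← Finset.prod_range_reflect (fun j => x - Q ^ (j + 1)), mul_assoc,
      ← prod_range_const_mul, ← Finset.prod_mul_distrib]
    refine Finset.prod_congr rfl fun k hk => ?_
    have : m = k + (m - 1 - k + 1) := by have := Finset.mem_range.mp hk; omega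
    nth_rewrite 1 [this]
    rw [pow_add]; ring
  have e2 : ∏ k ∈ Finset.range m, (Q ^ m - Q ^ k) =
      (∏ k ∈ Finset.range m, Q ^ k) * (-1) ^ m * ∏ j ∈ Finset.range m, (1 - Q ^ (j + 1)) := by
    rw [← Finset.prod_range_reflect (fun j => 1 - Q ^ (j + 1)), mul_assoc,
      ← prod_range_const_mul, ← Finset.prod_mul_distrib]
    refine Finset.prod_congr rfl fun k hk => ?_
    have : m = k + (m - 1 - k + 1) := by have := Finset.mem_range.mp hk; omega
    nth_rewrite 1 [this]
    rw [pow_add]; ring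
  have e3 : ∏ k ∈ Finset.range d, (Q ^ m - x * Q ^ (m + k)) =
      (Q ^ m) ^ d * qShiftedFin x Q d := by
    rw [qShiftedFin, ← prod_range_const_mul]
    exact Finset.prod_congr rfl fun k _ => by ring
  have e4 : ∏ k ∈ Finset.range d, (Q ^ m - Q ^ (m + 1 + k)) =
      (Q ^ m) ^ d * qShiftedFin Q Q d := by
    rw [qShiftedFin, ← prod_range_const_mul]
    exact Finset.prod_congr rfl fun k _ => by ring
  rw [e1, e2, e3, e4, Finset.prod_div_distrib]
  have n1 : ∏ k ∈ Finset.range m, Q ^ k ≠ 0 :=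
    Finset.prod_ne_zero_iff.mpr fun k _ => pow_ne_zero k hQ0
  have n2 : ∏ j ∈ Finset.range m, (1 - Q ^ (j + 1)) ≠ 0 :=
    Finset.prod_ne_zero_iff.mpr fun k _ => sub_ne_zero.mpr (hQ k).symm
  have n3 : qShiftedFin Q Q d ≠ 0 :=
    Finset.prod_ne_zero_iff.mpr fun k _ => by
      rw [← pow_succ']; exact sub_ne_zero.mpr (hQ k).symm
  have n4 : (Q ^ m) ^ d ≠ 0 := pow_ne_zero _ (pow_ne_zero _ hQ0)
  have n5 : ((-1 : ℂ)) ^ m ≠ 0 := pow_ne_zero _ (by norm_num)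
  field_simp

/-- Reversal of the order of the factors, which expresses the product by powers of `Q⁻¹` through a
`q`-shifted factorial. -/
theorem qShiftedFin_reflect (Q : ℂ) {c : ℂ} (hc : c ≠ 0) (s : ℂ) (N : ℕ) :
    ∏ k ∈ Finset.range N, (Q ^ N * s - c * Q ^ k) =
      (∏ k ∈ Finset.range N, Q ^ k) * (-c) ^ N * qShiftedFin (Q * s / c) Q N := by
  rw [qShiftedFin, ← Finset.prod_range_reflect (fun j => 1 - Q * s / c * Q ^ j), mul_assoc,
    ← prod_range_const_mul, ← Finset.prod_mul_distrib]
  refine Finset.prod_congr rfl fun k hk => ?_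
  have : N = k + (N - 1 - k + 1) := by have := Finset.mem_range.mp hk; omega
  nth_rewrite 1 [this]
  field_simp
  ring

/-- The finite form of the bilateral sum: `lagrange_partial_fractions` with `M = 2 N` and
`t = Q ^ N / y`, the index `m` standing for `n = m - N ∈ [-N, N]`. -/
theorem qShiftedFin_symm_partial_fractions {Q x y : ℂ} (hQ0 : Q ≠ 0)
    (hQ : ∀ j : ℕ, Q ^ (j + 1) ≠ 1) (hx : x ≠ 0) (hy : y ≠ 0)
    (hyQ : ∀ n : ℤ, 1 - y * Q ^ n ≠ 0) (N : ℕ) :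
    qShiftedFin (x * y) Q N * qShiftedFin (Q / (x * y)) Q N /
        (qShiftedFin y Q (N + 1) * qShiftedFin (Q / y) Q N) =
      ∑ m ∈ Finset.range (2 * N + 1),
        x ^ ((m : ℤ) - N) / (1 - y * Q ^ ((m : ℤ) - N)) *
          (qShiftedFin (Q / x) Q m / qShiftedFin Q Q m) *
          (qShiftedFin x Q (2 * N - m) / qShiftedFin Q Q (2 * N - m)) := by
  -- The substitution `t = Q ^ N / y` makes `t - Q ^ m` a constant multiple of
  -- `1 - y Q ^ (m - N)`.
  have hz : ∀ m : ℕ, Q ^ N * y⁻¹ - Q ^ m = Q ^ N * y⁻¹ * (1 - y * Q ^ ((m : ℤ) - N)) := fun m => by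
    rw [zpow_sub₀ hQ0, zpow_natCast, zpow_natCast]
    have := pow_ne_zero N hQ0
    field_simp
  have hQN := pow_ne_zero N hQ0
  have hb : Q ^ N * y⁻¹ ≠ 0 := mul_ne_zero hQN (inv_ne_zero hy)
  have key := lagrange_partial_fractions hQ0 hQ x (Q ^ N * y⁻¹) (2 * N) (fun k _ => by
    rw [← sub_ne_zero, hz]
    exact mul_ne_zero hb (hyQ _))
  have l1 : ∏ k ∈ Finset.range (2 * N), (Q ^ N * y⁻¹ - x * Q ^ k) =
      (∏ k ∈ Finset.range N, Q ^ k) * (-x) ^ N * qShiftedFin (Q / (x * y)) Q N *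
        ((Q ^ N * y⁻¹) ^ N * qShiftedFin (x * y) Q N) := by
    rw [two_mul, Finset.prod_range_add, qShiftedFin_reflect Q hx,
      show Q * y⁻¹ / x = Q / (x * y) by field_simp]
    congr 1
    rw [qShiftedFin, ← prod_range_const_mul]
    exact Finset.prod_congr rfl fun k _ => by field_simp; ring
  have l2 : ∏ k ∈ Finset.range (2 * N + 1), (Q ^ N * y⁻¹ - Q ^ k) =
      (∏ k ∈ Finset.range N, Q ^ k) * (-1) ^ N * qShiftedFin (Q / y) Q N *
        ((Q ^ N * y⁻¹) ^ (N + 1) * qShiftedFin y Q (N + 1)) := by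
    have := qShiftedFin_reflect Q one_ne_zero y⁻¹ N
    simp only [one_mul, div_one] at this
    rw [two_mul, add_assoc, Finset.prod_range_add, this, ← div_eq_mul_inv Q y]
    congr 1
    rw [qShiftedFin, ← prod_range_const_mul]
    exact Finset.prod_congr rfl fun k _ => by field_simp; ring
  have n1 : ∏ k ∈ Finset.range N, Q ^ k ≠ 0 :=
    Finset.prod_ne_zero_iff.mpr fun k _ => pow_ne_zero k hQ0
  have n2 : qShiftedFin y Q (N + 1) ≠ 0 := Finset.prod_ne_zero_iff.mpr fun k _ => by
    simpa using hyQ k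
  have n3 : qShiftedFin (Q / y) Q N ≠ 0 := Finset.prod_ne_zero_iff.mpr fun k _ => by
    have h := hyQ (-((k : ℤ) + 1))
    rw [zpow_neg, zpow_add_one₀ hQ0, zpow_natCast] at h
    intro h0
    apply h
    have := pow_ne_zero k hQ0
    field_simp at h0 ⊢
    linear_combination -h0
  have hsum : ∀ m ∈ Finset.range (2 * N + 1),
      x ^ ((m : ℤ) - N) / (1 - y * Q ^ ((m : ℤ) - N)) *
          (qShiftedFin (Q / x) Q m / qShiftedFin Q Q m) *
          (qShiftedFin x Q (2 * N - m) / qShiftedFin Q Q (2 * N - m)) =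
      (Q ^ N * y⁻¹) / x ^ N *
      ((∏ j ∈ Finset.range m, (x - Q ^ (j + 1)) / (1 - Q ^ (j + 1))) *
          (qShiftedFin x Q (2 * N - m) / qShiftedFin Q Q (2 * N - m)) /
          (Q ^ N * y⁻¹ - Q ^ m)) := fun m _ => by
    have h1 : ∏ j ∈ Finset.range m, (x - Q ^ (j + 1)) / (1 - Q ^ (j + 1)) =
        x ^ m * (qShiftedFin (Q / x) Q m / qShiftedFin Q Q m) := by
      rw [qShiftedFin, qShiftedFin, ← Finset.prod_div_distrib, ← prod_range_const_mul]
      refine Finset.prod_congr rfl fun k _ => ?_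
      rw [pow_succ', ← mul_div_assoc]
      congr 1
      field_simp
    rw [h1, hz, zpow_sub₀ hx, zpow_natCast, zpow_natCast, mul_comm (Q ^ N * y⁻¹) (1 - _),
      ← div_div _ _ (Q ^ N * y⁻¹)]
    have := pow_ne_zero N hx
    set A := qShiftedFin (Q / x) Q m / qShiftedFin Q Q m
    set B := qShiftedFin x Q (2 * N - m) / qShiftedFin Q Q (2 * N - m)
    set D := 1 - y * Q ^ ((m : ℤ) - N)
    clear_value A B D
    field_simp
  rw [Finset.sum_congr rfl hsum, ← Finset.mul_sum, ← key, l1, l2]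
  have hxN := pow_ne_zero N hx
  rw [show (-x) ^ N = (-1) ^ N * x ^ N by rw [← mul_pow]; ring, pow_succ (Q ^ N * y⁻¹) N]
  have n5 : ((-1 : ℂ)) ^ N ≠ 0 := pow_ne_zero _ (by norm_num)
  have n6 := pow_ne_zero N hb
  generalize Q ^ N * y⁻¹ = b at *
  generalize b ^ N = bN at *
  field_simp

/-! ### Convergence of q-products and the bilateral sum -/

theorem summable_norm_neg_mul_pow (a : ℂ) {Q : ℂ} (hQ : ‖Q‖ < 1) :
    Summable fun i : ℕ => ‖-(a * Q ^ i)‖ := by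
  simp only [norm_neg, norm_mul, norm_pow]
  exact (summable_geometric_of_lt_one (norm_nonneg _) hQ).mul_left _

theorem multipliable_one_sub_mul_pow (a : ℂ) {Q : ℂ} (hQ : ‖Q‖ < 1) :
    Multipliable fun i : ℕ => 1 - a * Q ^ i := by
  simpa only [← sub_eq_add_neg] using
    multipliable_one_add_of_summable (summable_norm_neg_mul_pow a hQ)

theorem qShifted_ne_zero {a Q : ℂ} (hQ : ‖Q‖ < 1) (h : ∀ i : ℕ, 1 - a * Q ^ i ≠ 0) :
    qShifted a Q ≠ 0 := by
  have := tprod_one_add_ne_zero_of_summable (f := fun i : ℕ => -(a * Q ^ i))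
    (fun i => by simpa only [← sub_eq_add_neg] using h i) (summable_norm_neg_mul_pow a hQ)
  simpa only [← sub_eq_add_neg, qShifted] using this

theorem one_sub_ne_zero_of_norm_lt_one {z : ℂ} (hz : ‖z‖ < 1) : 1 - z ≠ 0 := by
  rw [sub_ne_zero]
  rintro rfl
  simp at hz

theorem norm_mul_pow_lt_one {a Q : ℂ} (hQ : ‖Q‖ < 1) (ha : ‖a‖ < 1) (i : ℕ) :
    ‖a * Q ^ i‖ < 1 := by
  rw [norm_mul, norm_pow]
  exact lt_of_le_of_lt (mul_le_of_le_one_right (norm_nonneg _)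
    (pow_le_one₀ (norm_nonneg _) hQ.le)) ha

theorem qShifted_ne_zero_of_norm_lt_one {a Q : ℂ} (hQ : ‖Q‖ < 1) (ha : ‖a‖ < 1) :
    qShifted a Q ≠ 0 :=
  qShifted_ne_zero hQ fun i => one_sub_ne_zero_of_norm_lt_one (norm_mul_pow_lt_one hQ ha i)

theorem qShifted_eq_one_sub_mul (a : ℂ) {Q : ℂ} (hQ : ‖Q‖ < 1) :
    qShifted a Q = (1 - a) * qShifted (a * Q) Q := by
  have h : ∀ i : ℕ, 1 - a * Q ^ (i + 1) = 1 - a * Q * Q ^ i := fun i => by ring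
  have hm : Multipliable fun i : ℕ => 1 - a * Q ^ (i + 1) := by
    simpa only [h] using multipliable_one_sub_mul_pow (a * Q) hQ
  rw [qShifted, tprod_eq_zero_mul' (f := fun i : ℕ => 1 - a * Q ^ i) hm]
  simp only [h, pow_zero, mul_one, qShifted]

theorem tendsto_qShiftedFin (a : ℂ) {Q : ℂ} (hQ : ‖Q‖ < 1) :
    Tendsto (qShiftedFin a Q) atTop (𝓝 (qShifted a Q)) :=
  (multipliable_one_sub_mul_pow a hQ).hasProd.tendsto_prod_nat

theorem exists_norm_le_of_tendsto {u : ℕ → ℂ} {l : ℂ} (h : Tendsto u atTop (𝓝 l)) :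
    ∃ C : ℝ, 0 ≤ C ∧ ∀ n, ‖u n‖ ≤ C := by
  obtain ⟨C, hC⟩ := h.norm.bddAbove_range
  exact ⟨C, (norm_nonneg _).trans (hC ⟨0, rfl⟩), fun n => hC ⟨n, rfl⟩⟩

theorem summable_geometric_mul {u : ℕ → ℂ} {l r : ℂ} (h : Tendsto u atTop (𝓝 l))
    (hr : ‖r‖ < 1) : Summable fun n => r ^ n * u n := by
  obtain ⟨C, -, hC⟩ := exists_norm_le_of_tendsto h
  refine Summable.of_norm_bounded
    ((summable_geometric_of_lt_one (norm_nonneg r) hr).mul_right C) fun n => ?_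
  rw [norm_mul, norm_pow]
  exact mul_le_mul_of_nonneg_left (hC n) (by positivity)

theorem summable_zpow_div_one_sub {Q x y : ℂ} (hQ0 : Q ≠ 0) (hQx : ‖Q‖ < ‖x‖) (hx : ‖x‖ < 1)
    (hy : y ≠ 0) :
    Summable fun n : ℤ => x ^ n / (1 - y * Q ^ n) := by
  have hQ := hQx.trans hx
  have hx0 : x ≠ 0 := norm_pos_iff.mp ((norm_nonneg Q).trans_lt hQx)
  have hpow := tendsto_pow_atTop_nhds_zero_of_norm_lt_one hQ
  refine Summable.of_nat_of_neg ?_ ?_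
  · have h : Tendsto (fun n : ℕ => (1 - y * Q ^ n)⁻¹) atTop (𝓝 (1 - y * 0)⁻¹) :=
      ((hpow.const_mul y).const_sub 1).inv₀ (by simp)
    simpa [div_eq_mul_inv] using summable_geometric_mul h hx
  · have h : Tendsto (fun n : ℕ => (Q ^ n - y)⁻¹) atTop (𝓝 (0 - y)⁻¹) :=
      (hpow.sub_const y).inv₀ (by simpa using hy)
    have hr : ‖Q / x‖ < 1 := by
      rw [norm_div, div_lt_one (norm_pos_iff.mpr hx0)]
      exact hQx
    refine (summable_geometric_mul h hr).congr fun n => ?_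
    have hQn := pow_ne_zero n hQ0
    have hxn := pow_ne_zero n hx0
    rw [zpow_neg, zpow_neg, zpow_natCast, zpow_natCast, div_pow,
      show 1 - y * (Q ^ n)⁻¹ = (Q ^ n - y) * (Q ^ n)⁻¹ by field_simp]
    rw [div_eq_mul_inv _ (_ * _), mul_inv, inv_inv]
    ring

/-- Kronecker's bilateral sum (the case `b = a Q` of Ramanujan's `₁ψ₁` summation), as the limit
`N → ∞` of `qShiftedFin_symm_partial_fractions`. -/
theorem tsum_zpow_div_one_sub {Q x y : ℂ} (hQ0 : Q ≠ 0) (hQx : ‖Q‖ < ‖x‖) (hx : ‖x‖ < 1)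
    (hy : y ≠ 0) (hyQ : ∀ n : ℤ, 1 - y * Q ^ n ≠ 0) :
    ∑' n : ℤ, x ^ n / (1 - y * Q ^ n) =
      qShifted Q Q ^ 2 * (qShifted (x * y) Q * qShifted (Q / (x * y)) Q) /
        (qShifted x Q * qShifted (Q / x) Q * (qShifted y Q * qShifted (Q / y) Q)) := by
  have hQ := hQx.trans hx
  have hx0 : x ≠ 0 := norm_pos_iff.mp ((norm_nonneg Q).trans_lt hQx)
  have hQx' : ‖Q / x‖ < 1 := by
    rw [norm_div, div_lt_one (norm_pos_iff.mpr hx0)]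
    exact hQx
  have hQQ : ∀ j : ℕ, Q ^ (j + 1) ≠ 1 := fun j h => by
    have := one_sub_ne_zero_of_norm_lt_one (norm_mul_pow_lt_one hQ hQ j)
    rw [← pow_succ', h] at this
    simp at this
  have nQ := qShifted_ne_zero_of_norm_lt_one hQ hQ
  have nx := qShifted_ne_zero_of_norm_lt_one hQ hx
  have nQx := qShifted_ne_zero_of_norm_lt_one hQ hQx'
  have ny : qShifted y Q ≠ 0 := qShifted_ne_zero hQ fun i => by simpa using hyQ i
  have nQy : qShifted (Q / y) Q ≠ 0 := qShifted_ne_zero hQ fun k => by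
    have h := hyQ (-((k : ℤ) + 1))
    rw [zpow_neg, zpow_add_one₀ hQ0, zpow_natCast] at h
    intro h0
    apply h
    have := pow_ne_zero k hQ0
    field_simp at h0 ⊢
    linear_combination -h0
  set u : ℕ → ℂ := fun m => qShiftedFin (Q / x) Q m / qShiftedFin Q Q m with hu
  set v : ℕ → ℂ := fun m => qShiftedFin x Q m / qShiftedFin Q Q m with hv
  have hu' : Tendsto u atTop (𝓝 (qShifted (Q / x) Q / qShifted Q Q)) :=
    (tendsto_qShiftedFin _ hQ).div (tendsto_qShiftedFin _ hQ) nQ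
  have hv' : Tendsto v atTop (𝓝 (qShifted x Q / qShifted Q Q)) :=
    (tendsto_qShiftedFin _ hQ).div (tendsto_qShiftedFin _ hQ) nQ
  obtain ⟨C, hC0, hC⟩ := exists_norm_le_of_tendsto hu'
  obtain ⟨D, hD0, hD⟩ := exists_norm_le_of_tendsto hv'
  set g : ℤ → ℂ := fun n => x ^ n / (1 - y * Q ^ n) with hg
  -- The `N`-th partial fraction sum, extended by zero to all of `ℤ`.
  set F : ℕ → ℤ → ℂ := fun N n =>
    if n ∈ Finset.Icc (-(N : ℤ)) N then g n * u (N + n).toNat * v (N - n).toNat else 0 with hF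
  have hlim : Tendsto (fun N => ∑' n, F N n) atTop
      (𝓝 (∑' n, g n * (qShifted (Q / x) Q / qShifted Q Q) * (qShifted x Q / qShifted Q Q))) := by
    refine tendsto_tsum_of_dominated_convergence (bound := fun n => ‖g n‖ * C * D)
      (((summable_zpow_div_one_sub hQ0 hQx hx hy).norm.mul_right C).mul_right D) ?_ ?_
    · intro n
      have h1 : Tendsto (fun N : ℕ => ((N : ℤ) + n).toNat) atTop atTop :=
        tendsto_atTop.mpr fun b => by
          filter_upwards [eventually_ge_atTop (b + n.natAbs)] with N hN
          omega
      have h2 : Tendsto (fun N : ℕ => ((N : ℤ) - n).toNat) atTop atTop :=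
        tendsto_atTop.mpr fun b => by
          filter_upwards [eventually_ge_atTop (b + n.natAbs)] with N hN
          omega
      refine (((hu'.comp h1).const_mul (g n)).mul (hv'.comp h2)).congr' ?_
      filter_upwards [eventually_ge_atTop n.natAbs] with N hN
      have : n ∈ Finset.Icc (-(N : ℤ)) N := Finset.mem_Icc.mpr (by omega)
      simp only [hF, if_pos this, Function.comp]
    · refine Eventually.of_forall fun N n => ?_
      by_cases h : n ∈ Finset.Icc (-(N : ℤ)) N
      · simp only [hF, if_pos h, norm_mul]
        gcongr
        · exact hC _
        · exact hD _
      · simp only [hF, if_neg h, norm_zero]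
        positivity
  have hfin : ∀ N : ℕ, ∑' n, F N n =
      qShiftedFin (x * y) Q N * qShiftedFin (Q / (x * y)) Q N /
        (qShiftedFin y Q (N + 1) * qShiftedFin (Q / y) Q N) := fun N => by
    rw [qShiftedFin_symm_partial_fractions hQ0 hQQ hx0 hy hyQ,
      tsum_eq_sum (s := Finset.Icc (-(N : ℤ)) N) fun n hn => by simp only [hF, if_neg hn]]
    symm
    refine Finset.sum_bij (fun m _ => (m : ℤ) - N) ?_ ?_ ?_ ?_
    · intro m hm
      rw [Finset.mem_range] at hm
      rw [Finset.mem_Icc]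
      omega
    · intro m _ k _ h
      omega
    · intro n hn
      rw [Finset.mem_Icc] at hn
      exact ⟨(n + N).toNat, Finset.mem_range.mpr (by omega), by omega⟩
    · intro m hm
      rw [Finset.mem_range] at hm
      have h : (m : ℤ) - N ∈ Finset.Icc (-(N : ℤ)) N := Finset.mem_Icc.mpr (by omega)
      simp only [hF, if_pos h, hg, hu, hv]
      rw [show ((N : ℤ) + (m - N)).toNat = m by omega,
        show ((N : ℤ) - (m - N)).toNat = 2 * N - m by omega]
  have hlim' : Tendsto (fun N => ∑' n, F N n) atTop
      (𝓝 (qShifted (x * y) Q * qShifted (Q / (x * y)) Q /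
        (qShifted y Q * qShifted (Q / y) Q))) := by
    simp only [hfin]
    exact ((tendsto_qShiftedFin _ hQ).mul (tendsto_qShiftedFin _ hQ)).div
      (((tendsto_qShiftedFin _ hQ).comp (tendsto_add_atTop_nat 1)).mul
        (tendsto_qShiftedFin _ hQ)) (mul_ne_zero ny nQy)
  have := tendsto_nhds_unique hlim hlim'
  rw [tsum_mul_right, tsum_mul_right] at this
  field_simp at this ⊢
  linear_combination this

/-! ### The q-shifted factorial as an entire function, and Lambert series -/

theorem qShifted_mul_qShifted_neg (a : ℂ) {Q : ℂ} (hQ : ‖Q‖ < 1) :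
    qShifted a Q * qShifted (-a) Q = qShifted (a ^ 2) (Q ^ 2) := by
  rw [qShifted, qShifted, qShifted, ← (multipliable_one_sub_mul_pow a hQ).tprod_mul
    (multipliable_one_sub_mul_pow (-a) hQ)]
  exact tprod_congr fun i => by ring

theorem qShifted_mul_cube_roots (a : ℂ) {Q w : ℂ} (hQ : ‖Q‖ < 1) (hw : 1 + w + w ^ 2 = 0) :
    qShifted a Q * (qShifted (w * a) Q * qShifted (w ^ 2 * a) Q) = qShifted (a ^ 3) (Q ^ 3) := by
  rw [qShifted, qShifted, qShifted, qShifted,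
    ← (multipliable_one_sub_mul_pow (w * a) hQ).tprod_mul
      (multipliable_one_sub_mul_pow (w ^ 2 * a) hQ),
    ← (multipliable_one_sub_mul_pow a hQ).tprod_mul
      ((multipliable_one_sub_mul_pow (w * a) hQ).mul
        (multipliable_one_sub_mul_pow (w ^ 2 * a) hQ))]
  refine tprod_congr fun i => ?_
  rw [← pow_mul, mul_comm 3 i, pow_mul]
  generalize Q ^ i = t
  linear_combination (-(a * t) + (a * t) ^ 2 * w - (a * t) ^ 3 * (w - 1)) * hw

theorem multipliableLocallyUniformlyOn_one_sub_mul_pow {Q : ℂ} (hQ : ‖Q‖ < 1) :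
    MultipliableLocallyUniformlyOn (fun (i : ℕ) a => 1 - a * Q ^ i) Set.univ := by
  refine ⟨fun a => ∏' i : ℕ, (1 - a * Q ^ i), ?_⟩
  simp_rw [sub_eq_add_neg]
  refine hasProdLocallyUniformlyOn_of_forall_compact isOpen_univ fun K _ hK => ?_
  obtain ⟨R, hR⟩ := hK.isBounded.exists_norm_le
  have hs := (summable_geometric_of_lt_one (norm_nonneg Q) hQ).mul_left R
  refine hs.hasProdUniformlyOn_nat_one_add hK (.of_forall fun n a ha => ?_) (fun _ => by fun_prop)
  rw [norm_neg, norm_mul, norm_pow]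
  exact mul_le_mul_of_nonneg_right (hR a ha) (by positivity)

theorem differentiable_qShifted {Q : ℂ} (hQ : ‖Q‖ < 1) :
    Differentiable ℂ fun a => qShifted a Q := by
  rw [← differentiableOn_univ]
  have h := (multipliableLocallyUniformlyOn_one_sub_mul_pow hQ).hasProdLocallyUniformlyOn
  exact h.differentiableOn
    (.of_forall fun _ => by
      simpa [Finset.prod_fn] using DifferentiableOn.finsetProd (fun _ _ => by fun_prop))
    isOpen_univ

theorem summable_pow_mul_inv_one_sub (x : ℂ) {Q : ℂ} (hQ : ‖Q‖ < 1) :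
    Summable fun i : ℕ => Q ^ i * (1 - x * Q ^ i)⁻¹ := by
  have h : Tendsto (fun i : ℕ => (1 - x * Q ^ i)⁻¹) atTop (𝓝 (1 - x * 0)⁻¹) :=
    (((tendsto_pow_atTop_nhds_zero_of_norm_lt_one hQ).const_mul x).const_sub 1).inv₀ (by simp)
  exact summable_geometric_mul h hQ

/-- Expansion of each term into a geometric series and exchange of the two summations. -/
theorem tsum_lambert {x Q : ℂ} (hQ : ‖Q‖ < 1) (hx : ‖x‖ < 1) :
    ∑' i : ℕ, x * (Q ^ i * (1 - x * Q ^ i)⁻¹) = ∑' m : ℕ, x ^ (m + 1) / (1 - Q ^ (m + 1)) := by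
  have hs : Summable (Function.uncurry fun i m : ℕ => (x * Q ^ i) ^ (m + 1)) := by
    have h := Summable.mul_of_nonneg (summable_geometric_of_lt_one (norm_nonneg Q) hQ)
      (summable_geometric_of_lt_one (norm_nonneg x) hx) (fun i => by positivity)
      (fun i => by positivity)
    refine Summable.of_norm_bounded h fun p => ?_
    obtain ⟨i, m⟩ := p
    simp only [Function.uncurry_apply_pair, norm_pow, norm_mul]
    rw [mul_pow, mul_comm, ← pow_mul]
    refine mul_le_mul ?_ ?_ (by positivity) (by positivity)
    · exact pow_le_pow_of_le_one (norm_nonneg _) hQ.le (by nlinarith)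
    · exact pow_le_pow_of_le_one (norm_nonneg _) hx.le (by omega)
  have h1 : ∀ i : ℕ, ∑' m : ℕ, (x * Q ^ i) ^ (m + 1) = x * (Q ^ i * (1 - x * Q ^ i)⁻¹) := by
    intro i
    simp only [pow_succ]
    rw [tsum_mul_right, tsum_geometric_of_norm_lt_one (norm_mul_pow_lt_one hQ hx i)]
    ring
  have h2 : ∀ m : ℕ, ∑' i : ℕ, (x * Q ^ i) ^ (m + 1) = x ^ (m + 1) / (1 - Q ^ (m + 1)) := by
    intro m
    have : ‖Q ^ (m + 1)‖ < 1 := by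
      rw [norm_pow]
      exact pow_lt_one₀ (norm_nonneg _) hQ (by omega)
    rw [div_eq_mul_inv, ← tsum_geometric_of_norm_lt_one this, ← tsum_mul_left]
    exact tsum_congr fun i => by ring
  rw [← tsum_congr h1, ← tsum_congr h2]
  exact hs.tsum_comm.symm

theorem summable_lambert {x Q : ℂ} (hQ : ‖Q‖ < 1) (hx : ‖x‖ < 1) :
    Summable fun m : ℕ => x ^ (m + 1) / (1 - Q ^ (m + 1)) := by
  have h : Tendsto (fun m : ℕ => (1 - Q ^ (m + 1))⁻¹) atTop (𝓝 (1 - 0)⁻¹) :=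
    (((tendsto_pow_atTop_nhds_zero_of_norm_lt_one hQ).comp
      (tendsto_add_atTop_nat 1)).const_sub 1).inv₀ (by simp)
  refine ((summable_geometric_mul h hx).mul_left x).congr fun m => ?_
  ring

theorem mul_logDeriv_qShifted {x Q : ℂ} (hQ : ‖Q‖ < 1) (hx : ‖x‖ < 1) :
    x * logDeriv (fun a => qShifted a Q) x = -∑' m : ℕ, x ^ (m + 1) / (1 - Q ^ (m + 1)) := by
  have hd : ∀ i : ℕ, logDeriv (fun a : ℂ => 1 - a * Q ^ i) x = -(Q ^ i * (1 - x * Q ^ i)⁻¹) :=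
    fun i => by
      rw [logDeriv_apply, deriv_const_sub, deriv_mul_const (by fun_prop), deriv_id'']
      ring
  have h := logDeriv_tprod_eq_tsum (f := fun (i : ℕ) (a : ℂ) => 1 - a * Q ^ i) isOpen_univ
    (Set.mem_univ x)
    (fun i => one_sub_ne_zero_of_norm_lt_one (norm_mul_pow_lt_one hQ hx i))
    (fun i => by fun_prop)
    (by simpa only [hd] using (summable_pow_mul_inv_one_sub x hQ).neg)
    (multipliableLocallyUniformlyOn_one_sub_mul_pow hQ)
    (qShifted_ne_zero_of_norm_lt_one hQ hx)
  simp only [hd, tsum_neg] at h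
  simp only [qShifted]
  rw [h, mul_neg, ← tsum_mul_left, tsum_lambert hQ hx]

/-! ### The q-sine and q-cotangent -/

theorem qPow_add (τ s t : ℂ) : qPow τ (s + t) = qPow τ s * qPow τ t := by
  rw [qPow, qPow, qPow, ← Complex.exp_add]
  ring_nf

theorem qPow_ne_zero (τ s : ℂ) : qPow τ s ≠ 0 := Complex.exp_ne_zero _

theorem qPow_zero (τ : ℂ) : qPow τ 0 = 1 := by simp [qPow]

theorem qPow_mul_left (c τ s : ℂ) : qPow (c * τ) s = qPow τ (c * s) := by
  rw [qPow, qPow]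
  ring_nf

theorem qPow_nat_mul (τ : ℂ) (n : ℕ) (s : ℂ) : qPow τ (n * s) = qPow τ s ^ n := by
  rw [qPow, qPow, ← Complex.exp_nat_mul]
  ring_nf

theorem norm_qPow_ofReal (τ : ℂ) (s : ℝ) : ‖qPow τ s‖ = Real.exp (-(Real.pi * τ.im * s)) := by
  rw [qPow, Complex.norm_exp]
  congr 1
  simp [Complex.mul_re, Complex.mul_im]

theorem norm_qPow_ofReal_lt_one {τ : ℂ} (hτ : 0 < τ.im) {s : ℝ} (hs : 0 < s) :
    ‖qPow τ s‖ < 1 := by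
  rw [norm_qPow_ofReal, Real.exp_lt_one_iff]
  have := mul_pos (mul_pos Real.pi_pos hτ) hs
  linarith

theorem norm_qPow_one_lt_one {τ : ℂ} (hτ : 0 < τ.im) : ‖qPow τ 1‖ < 1 := by
  simpa using norm_qPow_ofReal_lt_one hτ one_pos

theorem norm_qPow_two_lt_one {τ : ℂ} (hτ : 0 < τ.im) : ‖qPow τ 2‖ < 1 := by
  simpa using norm_qPow_ofReal_lt_one hτ two_pos

/-- The theta product for the `q`-sine. It holds for all `z`: at a pole of one of the `q`-gamma
functions both sides vanish. -/
theorem sinQ_eq {τ : ℂ} (hτ : 0 < τ.im) (z : ℂ) :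
    sinQ τ z = qPow τ ((z / Real.pi - 1 / 2) ^ 2) *
      (qShifted (qPow τ (2 * (z / Real.pi))) (qPow τ 2) *
        qShifted (qPow τ (2 * (1 - z / Real.pi))) (qPow τ 2)) *
      (qShifted (qPow τ 1) (qPow τ 2) ^ 2)⁻¹ := by
  have hQ := norm_qPow_two_lt_one hτ
  have h1 : qShifted (qPow τ 1) (qPow τ 2) ≠ 0 :=
    qShifted_ne_zero_of_norm_lt_one hQ (norm_qPow_one_lt_one hτ)
  have h2 : qShifted (qPow τ 2) (qPow τ 2) ≠ 0 := qShifted_ne_zero_of_norm_lt_one hQ hQ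
  have hb : 1 - qPow τ 2 ≠ 0 := one_sub_ne_zero_of_norm_lt_one hQ
  rw [sinQ]
  generalize z / (Real.pi : ℂ) = w
  have e1 : (1 - qPow τ 2) ^ (1 - w) * (1 - qPow τ 2) ^ (1 - (1 - w)) = 1 - qPow τ 2 := by
    rw [← Complex.cpow_add _ _ hb]
    simp
  have e2 : ((1 - qPow τ 2) ^ (1 - (1 / 2 : ℂ))) ^ 2 = 1 - qPow τ 2 := by
    rw [← Complex.cpow_nat_mul]
    norm_num
  have e3 : qPow τ ((w - 1 / 2) ^ 2) = qPow τ (1 / 4) * qPow τ (w * (w - 1)) := by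
    rw [← qPow_add]
    ring_nf
  rw [e3]
  simp only [qGamma, qPow_mul_left]
  rw [show (2 : ℂ) * 1 = 2 by norm_num, show (2 : ℂ) * (1 / 2) = 1 by norm_num, mul_pow, e2,
    mul_mul_mul_comm (qShifted (qPow τ 2) (qPow τ 2) / _), e1]
  generalize qShifted (qPow τ (2 * w)) (qPow τ 2) = A
  generalize qShifted (qPow τ (2 * (1 - w))) (qPow τ 2) = B
  -- If `A` or `B` is zero, a `q`-gamma function has a pole; its value is then `0`, and so is the
  -- reciprocal of that value.
  by_cases hA : A = 0
  · simp [hA]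
  by_cases hB : B = 0
  · simp [hB]
  field_simp

theorem sinQ_pi_sub {τ : ℂ} (hτ : 0 < τ.im) (z : ℂ) : sinQ τ (Real.pi - z) = sinQ τ z := by
  have hpi : (Real.pi : ℂ) ≠ 0 := by exact_mod_cast Real.pi_ne_zero
  rw [sinQ_eq hτ, sinQ_eq hτ, sub_div, div_self hpi]
  ring_nf

/-- With `x = q ^ (2 w)` and `Q = q ^ 2`, the theta product acquires the factor `-1 / x` when `x` is
replaced by `x Q`, and the Gaussian factor `q ^ (w - 1/2)²` acquires the factor `x`. -/
theorem sinQ_add_pi {τ : ℂ} (hτ : 0 < τ.im) (z : ℂ) : sinQ τ (z + Real.pi) = -sinQ τ z := by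
  have hpi : (Real.pi : ℂ) ≠ 0 := by exact_mod_cast Real.pi_ne_zero
  have hQ := norm_qPow_two_lt_one hτ
  rw [sinQ_eq hτ, sinQ_eq hτ, add_div, div_self hpi]
  set w := z / (Real.pi : ℂ)
  have e1 := qShifted_eq_one_sub_mul (qPow τ (2 * w)) hQ
  have e2 := qShifted_eq_one_sub_mul (qPow τ (2 * (1 - (w + 1)))) hQ
  rw [← qPow_add] at e1 e2
  rw [show 2 * (1 - (w + 1)) + 2 = 2 * (1 - w) by ring] at e2
  rw [show (w + 1 - 1 / 2) ^ 2 = (w - 1 / 2) ^ 2 + 2 * w by ring, qPow_add τ _ (2 * w),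
    show 2 * (w + 1) = 2 * w + 2 by ring, e1, e2]
  have e3 : qPow τ (2 * w) * qPow τ (2 * (1 - (w + 1))) = 1 := by
    rw [← qPow_add, ← qPow_zero τ]
    ring_nf
  linear_combination (-qPow τ ((w - 1 / 2) ^ 2) * qShifted (qPow τ (2 * w + 2)) (qPow τ 2) *
    qShifted (qPow τ (2 * (1 - w))) (qPow τ 2) * (qShifted (qPow τ 1) (qPow τ 2) ^ 2)⁻¹) * e3

theorem sinQ_neg {τ : ℂ} (hτ : 0 < τ.im) (z : ℂ) : sinQ τ (-z) = -sinQ τ z := by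
  rw [← sinQ_pi_sub hτ z, sub_eq_neg_add, sinQ_add_pi hτ, neg_neg]

theorem differentiable_qPow (τ : ℂ) : Differentiable ℂ (qPow τ) := by
  unfold qPow
  fun_prop

theorem deriv_qPow (τ s : ℂ) : deriv (qPow τ) s = logQ τ * qPow τ s := by
  have h : HasDerivAt (fun s : ℂ => logQ τ * s) (logQ τ) s := by
    simpa using (hasDerivAt_id s).const_mul (logQ τ)
  rw [mul_comm]
  exact h.cexp.deriv

theorem differentiable_sinQ {τ : ℂ} (hτ : 0 < τ.im) : Differentiable ℂ (sinQ τ) := by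
  have hQ := differentiable_qShifted (norm_qPow_two_lt_one hτ)
  have hp := differentiable_qPow τ
  rw [funext (sinQ_eq hτ)]
  exact ((hp.comp (by fun_prop)).mul ((hQ.comp (hp.comp (by fun_prop))).mul
    (hQ.comp (hp.comp (by fun_prop))))).mul_const _

theorem cotQ_add_pi {τ : ℂ} (hτ : 0 < τ.im) (z : ℂ) : cotQ τ (z + Real.pi) = cotQ τ z := by
  have h : deriv (sinQ τ) (z + Real.pi) = -deriv (sinQ τ) z := by
    rw [← deriv_comp_add_const, funext (sinQ_add_pi hτ), deriv.fun_neg]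
  rw [cotQ, cotQ, h, sinQ_add_pi hτ, neg_div_neg_eq]

theorem cotQ_neg {τ : ℂ} (hτ : 0 < τ.im) (z : ℂ) : cotQ τ (-z) = -cotQ τ z := by
  have h : deriv (sinQ τ) (-z) = deriv (sinQ τ) z := by
    have := deriv_comp_neg (sinQ τ) z
    rw [funext (sinQ_neg hτ), deriv.fun_neg] at this
    exact (neg_injective this).symm
  rw [cotQ, cotQ, h, sinQ_neg hτ, div_neg]

theorem cotQ_add_int_mul_pi {τ : ℂ} (hτ : 0 < τ.im) (z : ℂ) (k : ℤ) :
    cotQ τ (z + k * Real.pi) = cotQ τ z :=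
  Function.Periodic.int_mul (cotQ_add_pi hτ) k z

theorem sinQ_add_int_mul_pi_ne_zero {τ : ℂ} (hτ : 0 < τ.im) {z : ℂ} (k : ℤ) (h : sinQ τ z ≠ 0) :
    sinQ τ (z + k * Real.pi) ≠ 0 := by
  have := Function.Antiperiodic.add_int_mul_eq (sinQ_add_pi hτ) k (x := z)
  rw [this]
  exact mul_ne_zero (by simp) h

theorem sinQ_ne_zero {τ : ℂ} (hτ : 0 < τ.im) {w : ℝ} (hw0 : 0 < w) (hw1 : w < 1) :
    sinQ τ (w * Real.pi) ≠ 0 := by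
  have hpi : (Real.pi : ℂ) ≠ 0 := by exact_mod_cast Real.pi_ne_zero
  have hQ := norm_qPow_two_lt_one hτ
  have hx : ‖qPow τ (2 * w)‖ < 1 := by
    exact_mod_cast norm_qPow_ofReal_lt_one hτ (s := 2 * w) (by linarith)
  have hx' : ‖qPow τ (2 * (1 - w))‖ < 1 := by
    exact_mod_cast norm_qPow_ofReal_lt_one hτ (s := 2 * (1 - w)) (by linarith)
  rw [sinQ_eq hτ, mul_div_cancel_right₀ _ hpi]
  exact mul_ne_zero (mul_ne_zero (qPow_ne_zero _ _)
    (mul_ne_zero (qShifted_ne_zero_of_norm_lt_one hQ hx) (qShifted_ne_zero_of_norm_lt_one hQ hx')))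
    (inv_ne_zero (pow_ne_zero 2 (qShifted_ne_zero_of_norm_lt_one hQ (norm_qPow_one_lt_one hτ))))

theorem cotQ_eq_lambert {τ : ℂ} (hτ : 0 < τ.im) {w : ℝ} (hw0 : 0 < w) (hw1 : w < 1) :
    cotQ τ (w * Real.pi) = logQ τ / Real.pi * (2 * w - 1 +
      2 * ∑' m : ℕ, (qPow τ (2 * (1 - w)) ^ (m + 1) - qPow τ (2 * w) ^ (m + 1)) /
        (1 - qPow τ 2 ^ (m + 1))) := by
  have hpi : (Real.pi : ℂ) ≠ 0 := by exact_mod_cast Real.pi_ne_zero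
  have hQ := norm_qPow_two_lt_one hτ
  have hx : ‖qPow τ (2 * w)‖ < 1 := by
    exact_mod_cast norm_qPow_ofReal_lt_one hτ (s := 2 * w) (by linarith)
  have hx' : ‖qPow τ (2 * (1 - w))‖ < 1 := by
    exact_mod_cast norm_qPow_ofReal_lt_one hτ (s := 2 * (1 - w)) (by linarith)
  have h1 : qShifted (qPow τ 1) (qPow τ 2) ≠ 0 :=
    qShifted_ne_zero_of_norm_lt_one hQ (norm_qPow_one_lt_one hτ)
  have hdp := differentiable_qPow τ
  have hdq := differentiable_qShifted hQ
  have hz : (w * Real.pi / Real.pi : ℂ) = w := mul_div_cancel_right₀ _ hpi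
  have l1 : logDeriv (fun z : ℂ => qPow τ ((z / Real.pi - 1 / 2) ^ 2)) (w * Real.pi) =
      logQ τ / Real.pi * (2 * w - 1) := by
    have hg : HasDerivAt (fun z : ℂ => (z / Real.pi - 1 / 2) ^ 2)
        (2 * (w * Real.pi / Real.pi - 1 / 2) * (1 / Real.pi) : ℂ) (w * Real.pi) := by
      have h0 : HasDerivAt (fun z : ℂ => z / Real.pi - 1 / 2) (1 / Real.pi : ℂ) (w * Real.pi) :=
        ((hasDerivAt_id (w * Real.pi : ℂ)).div_const (Real.pi : ℂ)).sub_const _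
      simpa using h0.fun_pow 2
    have := logDeriv_comp (f := qPow τ) hdp.differentiableAt hg.differentiableAt
    rw [hg.deriv, logDeriv_apply (qPow τ), deriv_qPow, mul_div_cancel_right₀ _ (qPow_ne_zero _ _),
      hz] at this
    refine this.trans ?_
    ring
  -- The two products are treated together, as `qShifted (q ^ (2 (a + b w))) (q ^ 2)` with
  -- `(a, b) = (0, 1)` and `(a, b) = (1, -1)`.
  have l2 : ∀ a b : ℂ, ‖qPow τ (2 * (a + b * w))‖ < 1 →
      logDeriv (fun z : ℂ => qShifted (qPow τ (2 * (a + b * (z / Real.pi)))) (qPow τ 2))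
        (w * Real.pi) = -(logQ τ / Real.pi * (2 * b)) *
          ∑' m : ℕ, qPow τ (2 * (a + b * w)) ^ (m + 1) / (1 - qPow τ 2 ^ (m + 1)) := by
    intro a b hab
    have hg : HasDerivAt (fun z : ℂ => 2 * (a + b * (z / Real.pi)))
        (2 * (b * (1 / Real.pi))) (w * Real.pi) := by
      simpa using ((((hasDerivAt_id (w * Real.pi : ℂ)).div_const (Real.pi : ℂ)).const_mul
        b).const_add a).const_mul 2
    have h := (hdp.differentiableAt (x := 2 * (a + b * (w * Real.pi / Real.pi)))).hasDerivAt.comp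
      (w * Real.pi : ℂ) hg
    have := logDeriv_comp (f := fun a => qShifted a (qPow τ 2)) hdq.differentiableAt
      h.differentiableAt
    rw [h.deriv, deriv_qPow] at this
    refine this.trans ?_
    simp only [Function.comp, hz]
    have hm := mul_logDeriv_qShifted hQ hab
    linear_combination (logQ τ * (2 * (b * (1 / Real.pi)))) * hm
  have l3 := l2 0 1 (by simpa using hx)
  have l4 := l2 1 (-1) (by simpa [← sub_eq_add_neg] using hx')
  simp only [zero_add, one_mul, neg_one_mul, ← sub_eq_add_neg] at l3 l4
  have d1 : DifferentiableAt ℂ (fun z : ℂ => qPow τ ((z / Real.pi - 1 / 2) ^ 2)) (w * Real.pi) :=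
    (hdp.comp (by fun_prop)).differentiableAt
  have d2 : DifferentiableAt ℂ (fun z : ℂ => qShifted (qPow τ (2 * (z / Real.pi))) (qPow τ 2))
      (w * Real.pi) := (hdq.comp (hdp.comp (by fun_prop))).differentiableAt
  have d3 : DifferentiableAt ℂ
      (fun z : ℂ => qShifted (qPow τ (2 * (1 - z / Real.pi))) (qPow τ 2))
      (w * Real.pi) := (hdq.comp (hdp.comp (by fun_prop))).differentiableAt
  have n2 := qShifted_ne_zero_of_norm_lt_one hQ hx
  have n3 := qShifted_ne_zero_of_norm_lt_one hQ hx'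
  nth_rewrite 1 [← hz] at n2 n3
  have m2 := logDeriv_mul (f := fun z : ℂ => qShifted (qPow τ (2 * (z / Real.pi))) (qPow τ 2))
    (g := fun z : ℂ => qShifted (qPow τ (2 * (1 - z / Real.pi))) (qPow τ 2)) _ n2 n3 d2 d3
  have m1 := logDeriv_mul (f := fun z : ℂ => qPow τ ((z / Real.pi - 1 / 2) ^ 2))
    (g := fun z : ℂ => qShifted (qPow τ (2 * (z / Real.pi))) (qPow τ 2) *
      qShifted (qPow τ (2 * (1 - z / Real.pi))) (qPow τ 2)) (w * Real.pi : ℂ)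
    (qPow_ne_zero _ _) (mul_ne_zero n2 n3) d1 (d2.fun_mul d3)
  change logDeriv (sinQ τ) _ = _
  rw [funext (sinQ_eq hτ), logDeriv_mul_const _ _ (inv_ne_zero (pow_ne_zero 2 h1)),
    m1, m2, l1, l3, l4]
  simp only [sub_div]
  rw [(summable_lambert hQ hx').tsum_sub (summable_lambert hQ hx)]
  ring

/-! ### The two Lambert series as quotients of q-products -/

theorem one_sub_mul_zpow_ne_zero {Q y : ℂ} (hQ : ‖Q‖ < 1) (hy : ‖y‖ = 1)
    (hy1 : y ≠ 1) (n : ℤ) : 1 - y * Q ^ n ≠ 0 := by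
  intro h
  have h1 : y * Q ^ n = 1 := (sub_eq_zero.mp h).symm
  have h2 : ‖Q‖ ^ n = 1 := by
    have := congrArg norm h1
    rwa [norm_mul, hy, one_mul, norm_zpow, norm_one] at this
  rcases (zpow_eq_one_iff_right₀ (norm_nonneg Q) hQ.ne).mp h2 with rfl
  exact hy1 (by simpa using h1)

theorem tsum_int_eq_add_tsum_pair {f : ℤ → ℂ} (hf : Summable f) :
    ∑' n : ℤ, f n = f 0 + ∑' m : ℕ, (f ((m + 1 : ℕ) : ℤ) + f (-((m + 1 : ℕ) : ℤ))) := by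
  have hinj1 : Function.Injective fun m : ℕ => ((m + 1 : ℕ) : ℤ) := fun m k h => by
    simpa using h
  have hinj2 : Function.Injective fun m : ℕ => -((m + 1 : ℕ) : ℤ) := fun m k h => by
    simpa using h
  have h1 := hf.comp_injective hinj1
  have h2 := hf.comp_injective hinj2
  have h := tsum_of_add_one_of_neg_add_one (f := f) (by simpa using! h1) (by simpa using! h2)
  have h3 := h1.tsum_add h2
  simp only [Function.comp, Nat.cast_add, Nat.cast_one] at h3 ⊢
  rw [h, h3]
  ring

theorem one_sub_pow_ne_zero {q : ℂ} (hq : ‖q‖ < 1) {k : ℕ} (hk : k ≠ 0) : 1 - q ^ k ≠ 0 :=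
  one_sub_ne_zero_of_norm_lt_one (by
    rw [norm_pow]
    exact pow_lt_one₀ (norm_nonneg q) hq hk)

theorem norm_sq_lt_norm {q : ℂ} (hq0 : q ≠ 0) (hq : ‖q‖ < 1) : ‖q ^ 2‖ < ‖q‖ := by
  rw [norm_pow, sq]
  exact mul_lt_of_lt_one_left (norm_pos_iff.mpr hq0) hq

/-- The bilateral sum at `x = q`, `Q = q ^ 2`, `y = -1`. This is Jacobi's two-square theorem, the
theta series being written as a quotient of products. -/
theorem lambert_four_eq_qShifted {q : ℂ} (hq0 : q ≠ 0) (hq : ‖q‖ < 1) :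
    1 - 4 * ∑' m : ℕ, ((q ^ 3) ^ (m + 1) - q ^ (m + 1)) / (1 - (q ^ 4) ^ (m + 1)) =
      (qShifted (q ^ 2) (q ^ 2) ^ 2 / qShifted q (q ^ 2) ^ 2) ^ 2 /
        (qShifted (q ^ 4) (q ^ 4) ^ 2 / qShifted (q ^ 2) (q ^ 4) ^ 2) := by
  have hQ0 : q ^ 2 ≠ 0 := pow_ne_zero 2 hq0
  have hQq := norm_sq_lt_norm hq0 hq
  have hQ := hQq.trans hq
  have hnz := one_sub_mul_zpow_ne_zero hQ (y := -1) (by simp) (by norm_num)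
  have hsum := summable_zpow_div_one_sub hQ0 hQq hq (y := -1) (by norm_num)
  have hK := tsum_zpow_div_one_sub hQ0 hQq hq (y := -1) (by norm_num) hnz
  rw [tsum_int_eq_add_tsum_pair hsum] at hK
  -- With `t = q ^ (m + 1)`, both terms of the pair equal
  -- `t / (1 + t ^ 2) = (t - t ^ 3) / (1 - t ^ 4)`.
  have hterm : ∀ m : ℕ, q ^ ((m + 1 : ℕ) : ℤ) / (1 - -1 * (q ^ 2) ^ ((m + 1 : ℕ) : ℤ)) +
      q ^ (-((m + 1 : ℕ) : ℤ)) / (1 - -1 * (q ^ 2) ^ (-((m + 1 : ℕ) : ℤ))) =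
      -2 * (((q ^ 3) ^ (m + 1) - q ^ (m + 1)) / (1 - (q ^ 4) ^ (m + 1))) := fun m => by
    have h1 := hnz ((m + 1 : ℕ) : ℤ)
    have h2 : 1 - (q ^ (m + 1)) ^ 2 ≠ 0 := by
      rw [← pow_mul]
      exact one_sub_pow_ne_zero hq (by omega)
    rw [zpow_neg, zpow_neg, zpow_natCast, zpow_natCast]
    rw [zpow_natCast] at h1
    simp only [← pow_mul, mul_comm _ (m + 1)] at h1 ⊢
    simp only [pow_mul] at h1 ⊢
    have ht := pow_ne_zero (m + 1) hq0
    generalize q ^ (m + 1) = t at *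
    have h3 : 1 + t ^ 2 ≠ 0 := by simpa using h1
    have h5 : t⁻¹ / (1 - -1 * (t ^ 2)⁻¹) = t / (1 + t ^ 2) := by
      rw [show 1 - -1 * (t ^ 2)⁻¹ = (1 + t ^ 2) / t ^ 2 by field_simp; ring]
      field_simp
    rw [h5, show 1 - -1 * t ^ 2 = 1 + t ^ 2 by ring,
      show 1 - t ^ 4 = (1 - t ^ 2) * (1 + t ^ 2) by ring]
    field_simp
    ring
  rw [tsum_congr hterm, tsum_mul_left] at hK
  have e1 := qShifted_mul_qShifted_neg q hQ
  have e2 := qShifted_mul_qShifted_neg (q ^ 2) hQ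
  have e3 := qShifted_eq_one_sub_mul (-1) hQ
  rw [← pow_mul] at e1 e2
  rw [neg_one_mul] at e3
  norm_num at e1 e2 e3 hK
  have hneg : ‖-q‖ < 1 := by rwa [norm_neg]
  have hneg2 : ‖-q ^ 2‖ < 1 := by rwa [norm_neg]
  have n1 := qShifted_ne_zero_of_norm_lt_one hQ hq
  have n2 := qShifted_ne_zero_of_norm_lt_one hQ hQ
  have n3 := qShifted_ne_zero_of_norm_lt_one hQ hneg
  have n4 := qShifted_ne_zero_of_norm_lt_one hQ hneg2
  rw [← e1, ← e2]
  rw [e3, show q ^ 2 / q = q by field_simp, show q ^ 2 / -q = -q by field_simp,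
    div_neg, div_one] at hK
  generalize qShifted q (q ^ 2) = A at *
  generalize qShifted (q ^ 2) (q ^ 2) = B at *
  generalize qShifted (-q) (q ^ 2) = C at *
  generalize qShifted (-q ^ 2) (q ^ 2) = D at *
  have hR : (B ^ 2 / A ^ 2) ^ 2 / ((B * D) ^ 2 / (A * C) ^ 2) =
      2 * (B ^ 2 * (C * C) / (A * A * (2 * D * D))) := by
    field_simp
  rw [hR, ← hK]
  ring

/-- The bilateral sum at `x = q`, `Q = q ^ 2` and `y = w`, a primitive cube root of unity. -/
theorem lambert_six_eq_qShifted {q : ℂ} (hq0 : q ≠ 0) (hq : ‖q‖ < 1) :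
    1 - 3 * ∑' m : ℕ, ((q ^ 5) ^ (m + 1) - q ^ (m + 1)) / (1 - (q ^ 6) ^ (m + 1)) =
      (qShifted (q ^ 2) (q ^ 2) / qShifted q (q ^ 2)) ^ 3 /
        (qShifted (q ^ 6) (q ^ 6) / qShifted (q ^ 3) (q ^ 6)) := by
  have hw := Complex.isPrimitiveRoot_exp 3 (by norm_num)
  generalize Complex.exp (2 * Real.pi * Complex.I / (3 : ℕ)) = w at hw
  have hw1 : w ≠ 1 := hw.ne_one (by norm_num)
  have hws : 1 + w + w ^ 2 = 0 := by
    have := hw.geom_sum_eq_zero (by norm_num)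
    simpa [Finset.sum_range_succ] using this
  have hw0 : w ≠ 0 := hw.ne_zero (by norm_num)
  have hwn : ‖w‖ = 1 := hw.norm'_eq_one (by norm_num)
  have hw3 : w ^ 3 = 1 := hw.pow_eq_one
  clear hw
  have hw1' : 1 - w ≠ 0 := sub_ne_zero.mpr hw1.symm
  have hQ0 : q ^ 2 ≠ 0 := pow_ne_zero 2 hq0
  have hQq := norm_sq_lt_norm hq0 hq
  have hQ := hQq.trans hq
  have hnz := one_sub_mul_zpow_ne_zero hQ hwn hw1
  have hsum := summable_zpow_div_one_sub hQ0 hQq hq hw0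
  have hK := tsum_zpow_div_one_sub hQ0 hQq hq hw0 hnz
  rw [tsum_int_eq_add_tsum_pair hsum] at hK
  -- With `t = q ^ (m + 1)`, the pair is `t / (1 - w t ^ 2) + t / (t ^ 2 - w)`; the constant
  -- comes from `w² (1 - w)² = -3`.
  have hterm : ∀ m : ℕ, q ^ ((m + 1 : ℕ) : ℤ) / (1 - w * (q ^ 2) ^ ((m + 1 : ℕ) : ℤ)) +
      q ^ (-((m + 1 : ℕ) : ℤ)) / (1 - w * (q ^ 2) ^ (-((m + 1 : ℕ) : ℤ))) =
      -3 / (1 - w) * (((q ^ 5) ^ (m + 1) - q ^ (m + 1)) / (1 - (q ^ 6) ^ (m + 1))) := fun m => by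
    have h1 := hnz ((m + 1 : ℕ) : ℤ)
    have h1' := hnz (-((m + 1 : ℕ) : ℤ))
    have h2 : 1 - (q ^ (m + 1)) ^ 2 ≠ 0 := by
      rw [← pow_mul]
      exact one_sub_pow_ne_zero hq (by omega)
    rw [zpow_neg, zpow_neg, zpow_natCast, zpow_natCast]
    rw [zpow_neg, zpow_natCast] at h1'
    rw [zpow_natCast] at h1
    simp only [← pow_mul, mul_comm _ (m + 1)] at h1 h1' ⊢
    simp only [pow_mul] at h1 h1' ⊢
    have ht := pow_ne_zero (m + 1) hq0
    generalize q ^ (m + 1) = t at *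
    have h3 : t ^ 2 - w ≠ 0 := fun h => h1' (by
      field_simp
      rw [h, mul_zero])
    -- `1 - t ^ 6` is the product of `1 - t ^ 2`, `1 - w t ^ 2` and
    -- `1 - w² t ^ 2 = -w² (t ^ 2 - w)`.
    have h4 : 1 - t ^ 6 = (1 - t ^ 2) * (1 - w * t ^ 2) * (w ^ 2 * (t ^ 2 - w)) * (-1) := by
      linear_combination (t ^ 2 - w * t ^ 4) * hws + (t ^ 6 - (1 - t ^ 2) * (1 - w * t ^ 2)) * hw3
    have h5 : t⁻¹ / (1 - w * (t ^ 2)⁻¹) = t / (t ^ 2 - w) := by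
      rw [show 1 - w * (t ^ 2)⁻¹ = (t ^ 2 - w) / t ^ 2 by field_simp]
      field_simp
    rw [h5, h4]
    rw [mul_comm w] at h1 ⊢
    field_simp
    linear_combination (1 - t ^ 4) * hws + (1 - t ^ 4) * (w - 2) * hw3
  rw [tsum_congr hterm, tsum_mul_left] at hK
  have e1 := qShifted_mul_cube_roots q hQ hws
  have e2 := qShifted_mul_cube_roots (q ^ 2) hQ hws
  have e3 := qShifted_eq_one_sub_mul w hQ
  have hw2n : ‖w ^ 2‖ = 1 := by rw [norm_pow, hwn, one_pow]
  have n1 := qShifted_ne_zero_of_norm_lt_one hQ hq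
  have n2 := qShifted_ne_zero_of_norm_lt_one hQ hQ
  have n3 : qShifted (w * q) (q ^ 2) ≠ 0 :=
    qShifted_ne_zero_of_norm_lt_one hQ (by rwa [norm_mul, hwn, one_mul])
  have n4 : qShifted (w ^ 2 * q) (q ^ 2) ≠ 0 :=
    qShifted_ne_zero_of_norm_lt_one hQ (by rwa [norm_mul, hw2n, one_mul])
  have n5 : qShifted (w * q ^ 2) (q ^ 2) ≠ 0 :=
    qShifted_ne_zero_of_norm_lt_one hQ (by rwa [norm_mul, hwn, one_mul])
  have n6 : qShifted (w ^ 2 * q ^ 2) (q ^ 2) ≠ 0 :=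
    qShifted_ne_zero_of_norm_lt_one hQ (by rwa [norm_mul, hw2n, one_mul])
  have s1 : q ^ 2 / (q * w) = w ^ 2 * q := by
    field_simp
    linear_combination -hw3
  have s2 : q ^ 2 / w = w ^ 2 * q ^ 2 := by
    field_simp
    linear_combination -hw3
  have s3 : q ^ 2 / q = q := by field_simp
  rw [e3, s1, s2, s3, mul_comm q w, zpow_zero, zpow_zero, mul_one] at hK
  simp only [← pow_mul, Nat.reduceMul] at e1 e2 hK ⊢
  rw [← e1, ← e2]
  generalize qShifted q (q ^ 2) = A at *
  generalize qShifted (q ^ 2) (q ^ 2) = B at *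
  generalize qShifted (w * q) (q ^ 2) = C at *
  generalize qShifted (w ^ 2 * q) (q ^ 2) = D at *
  generalize qShifted (w * q ^ 2) (q ^ 2) = E at *
  generalize qShifted (w ^ 2 * q ^ 2) (q ^ 2) = F at *
  have hR : (B / A) ^ 3 / (B * (E * F) / (A * (C * D))) =
      (1 - w) * (B ^ 2 * (C * D) / (A * A * ((1 - w) * E * F))) := by
    field_simp
  rw [hR, ← hK, mul_add, ← mul_assoc, mul_div_cancel₀ _ hw1', mul_div_cancel₀ _ hw1']
  ring

/-! ### Special values of the q-cotangent -/

theorem gosperPi_sq_div {τ : ℂ} (hτ : 0 < τ.im) :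
    gosperPi τ ^ 2 / gosperPi (2 * τ) =
      1 - 4 * ∑' m : ℕ, ((qPow τ 1 ^ 3) ^ (m + 1) - qPow τ 1 ^ (m + 1)) /
        (1 - (qPow τ 1 ^ 4) ^ (m + 1)) := by
  have h := fun n : ℕ => qPow_nat_mul τ n 1
  have h2 := h 2
  have h4 := h 4
  norm_num at h2 h4
  rw [lambert_four_eq_qShifted (qPow_ne_zero τ 1) (norm_qPow_one_lt_one hτ), gosperPi, gosperPi]
  simp only [qPow_mul_left]
  norm_num
  rw [← h2, ← h4]
  -- The powers of `q` outside the products cancel: `(q ^ (1/4)) ^ 2 = (q ^ 2) ^ (1/4)`.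
  have e : qPow τ (1 / 2) = qPow τ (1 / 4) ^ 2 := by
    rw [← qPow_nat_mul]
    norm_num
  rw [e]
  have := qPow_ne_zero τ (1 / 4)
  have key : ∀ c X Y : ℂ, c ≠ 0 → (c * X) ^ 2 / (c ^ 2 * Y) = X ^ 2 / Y := fun c X Y hc => by
    rw [mul_pow, mul_div_mul_left _ _ (pow_ne_zero 2 hc)]
  rw [mul_div_assoc, mul_div_assoc, key _ _ _ this]

theorem gosperPiSqrt_cube_div {τ : ℂ} (hτ : 0 < τ.im) :
    gosperPiSqrt τ ^ 3 / gosperPiSqrt (3 * τ) =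
      1 - 3 * ∑' m : ℕ, ((qPow τ 1 ^ 5) ^ (m + 1) - qPow τ 1 ^ (m + 1)) /
        (1 - (qPow τ 1 ^ 6) ^ (m + 1)) := by
  have h := fun n : ℕ => qPow_nat_mul τ n 1
  have h2 := h 2
  have h3 := h 3
  have h6 := h 6
  norm_num at h2 h3 h6
  rw [lambert_six_eq_qShifted (qPow_ne_zero τ 1) (norm_qPow_one_lt_one hτ), gosperPiSqrt,
    gosperPiSqrt]
  simp only [qPow_mul_left]
  norm_num
  rw [← h2, ← h3, ← h6]
  -- The powers of `q` outside the products cancel: `(q ^ (1/8)) ^ 3 = (q ^ 3) ^ (1/8)`.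
  have e : qPow τ (3 / 8) = qPow τ (1 / 8) ^ 3 := by
    rw [← qPow_nat_mul]
    norm_num
  rw [e]
  have := qPow_ne_zero τ (1 / 8)
  have key : ∀ c X Y : ℂ, c ≠ 0 → (c * X) ^ 3 / (c ^ 3 * Y) = X ^ 3 / Y := fun c X Y hc => by
    rw [mul_pow, mul_div_mul_left _ _ (pow_ne_zero 3 hc)]
  rw [mul_div_assoc, mul_div_assoc, key _ _ _ this]

theorem cotQ_pi_div_four {τ : ℂ} (hτ : 0 < τ.im) :
    cotQ (2 * τ) (((1 / 4 : ℝ) : ℂ) * Real.pi) =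
      -(logQ τ / Real.pi * (gosperPi τ ^ 2 / gosperPi (2 * τ))) := by
  have h2τ : 0 < (2 * τ).im := by simpa using hτ
  have h := fun n : ℕ => qPow_nat_mul τ n 1
  have h3 := h 3
  have h4 := h 4
  norm_num at h3 h4
  rw [cotQ_eq_lambert h2τ (by norm_num) (by norm_num), gosperPi_sq_div hτ]
  simp only [qPow_mul_left]
  norm_num
  rw [h3, h4, logQ, logQ]
  ring

theorem cotQ_pi_div_six {τ : ℂ} (hτ : 0 < τ.im) :
    cotQ (3 * τ) (((1 / 6 : ℝ) : ℂ) * Real.pi) =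
      -(2 * logQ τ / Real.pi * (gosperPiSqrt τ ^ 3 / gosperPiSqrt (3 * τ))) := by
  have h3τ : 0 < (3 * τ).im := by simpa using hτ
  have h := fun n : ℕ => qPow_nat_mul τ n 1
  have h5 := h 5
  have h6 := h 6
  norm_num at h5 h6
  rw [cotQ_eq_lambert h3τ (by norm_num) (by norm_num), gosperPiSqrt_cube_div hτ]
  simp only [qPow_mul_left]
  norm_num
  rw [h5, h6, logQ, logQ]
  ring

theorem cotQ_pi_div_two {τ : ℂ} (hτ : 0 < τ.im) :
    cotQ τ (((1 / 2 : ℝ) : ℂ) * Real.pi) = 0 := by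
  have h := cotQ_add_pi hτ (-(((1 / 2 : ℝ) : ℂ) * Real.pi))
  rw [cotQ_neg hτ, show -(((1 / 2 : ℝ) : ℂ) * Real.pi) + Real.pi = ((1 / 2 : ℝ) : ℂ) * Real.pi by
    push_cast; ring] at h
  exact self_eq_neg.mp h

theorem cotQ_neg_add_int_mul_pi {τ : ℂ} (hτ : 0 < τ.im) (z : ℂ) (k : ℤ) :
    cotQ τ (-z + k * Real.pi) = -cotQ τ z := by
  rw [cotQ_add_int_mul_pi hτ, cotQ_neg hτ]

theorem sinQ_neg_add_int_mul_pi_ne_zero {τ : ℂ} (hτ : 0 < τ.im) {z : ℂ} (k : ℤ)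
    (h : sinQ τ z ≠ 0) : sinQ τ (-z + k * Real.pi) ≠ 0 :=
  sinQ_add_int_mul_pi_ne_zero hτ k (by rwa [sinQ_neg hτ, neg_ne_zero])


theorem odd_pi_div_four (a : ℤ) (ha : Odd a) :
    (a ≡ 1 [ZMOD 4] ∧ ∃ k : ℤ, (a * Real.pi / 4 : ℂ) = ((1 / 4 : ℝ) : ℂ) * Real.pi + k * Real.pi) ∨
    (a ≡ -1 [ZMOD 4] ∧
      ∃ k : ℤ, (a * Real.pi / 4 : ℂ) = -(((1 / 4 : ℝ) : ℂ) * Real.pi) + k * Real.pi) := by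
  obtain ⟨b, rfl⟩ := ha
  obtain ⟨k, rfl | rfl⟩ := Int.even_or_odd' b
  · exact Or.inl ⟨by rw [Int.ModEq]; omega, k, by push_cast; ring⟩
  · exact Or.inr ⟨by rw [Int.ModEq]; omega, k + 1, by push_cast; ring⟩

theorem odd_pi_div_six (a : ℤ) (ha : Odd a) :
    (a ≡ 1 [ZMOD 6] ∧ ∃ k : ℤ, (a * Real.pi / 6 : ℂ) = ((1 / 6 : ℝ) : ℂ) * Real.pi + k * Real.pi) ∨
    (a ≡ -1 [ZMOD 6] ∧
      ∃ k : ℤ, (a * Real.pi / 6 : ℂ) = -(((1 / 6 : ℝ) : ℂ) * Real.pi) + k * Real.pi) ∨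
    (a ≡ 3 [ZMOD 6] ∧
      ∃ k : ℤ, (a * Real.pi / 6 : ℂ) = ((1 / 2 : ℝ) : ℂ) * Real.pi + k * Real.pi) := by
  obtain ⟨b, rfl⟩ := ha
  have h : b = 3 * (b / 3) ∨ b = 3 * (b / 3) + 1 ∨ b = 3 * (b / 3) + 2 := by omega
  generalize b / 3 = k at h
  rcases h with rfl | rfl | rfl
  · exact Or.inl ⟨by rw [Int.ModEq]; omega, k, by push_cast; ring⟩
  · exact Or.inr (Or.inr ⟨by rw [Int.ModEq]; omega, k, by push_cast; ring⟩)
  · exact Or.inr (Or.inl ⟨by rw [Int.ModEq]; omega, k + 1, by push_cast; ring⟩)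

end GosperTrig

theorem mainTheorem3 (τ : ℂ) (hτ : 0 < τ.im) (a : ℤ) (ha : Odd a) :
    (DifferentiableAt ℂ (GosperTrig.sinQ (2 * τ)) (a * Real.pi / 4) ∧
      GosperTrig.sinQ (2 * τ) (a * Real.pi / 4) ≠ 0 ∧
      (a ≡ 1 [ZMOD 8] ∨ a ≡ -3 [ZMOD 8] →
        GosperTrig.cotQ (2 * τ) (a * Real.pi / 4) =
          -(GosperTrig.logQ τ / Real.pi *
            (GosperTrig.gosperPi τ ^ 2 / GosperTrig.gosperPi (2 * τ)))) ∧
      (a ≡ -1 [ZMOD 8] ∨ a ≡ 3 [ZMOD 8] →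
        GosperTrig.cotQ (2 * τ) (a * Real.pi / 4) =
          GosperTrig.logQ τ / Real.pi *
            (GosperTrig.gosperPi τ ^ 2 / GosperTrig.gosperPi (2 * τ)))) ∧
    (DifferentiableAt ℂ (GosperTrig.sinQ (3 * τ)) (a * Real.pi / 6) ∧
      GosperTrig.sinQ (3 * τ) (a * Real.pi / 6) ≠ 0 ∧
      (a ≡ 1 [ZMOD 12] ∨ a ≡ -5 [ZMOD 12] →
        GosperTrig.cotQ (3 * τ) (a * Real.pi / 6) =
          -(2 * GosperTrig.logQ τ / Real.pi *
            (GosperTrig.gosperPiSqrt τ ^ 3 / GosperTrig.gosperPiSqrt (3 * τ)))) ∧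
      (a ≡ -1 [ZMOD 12] ∨ a ≡ 5 [ZMOD 12] →
        GosperTrig.cotQ (3 * τ) (a * Real.pi / 6) =
          2 * GosperTrig.logQ τ / Real.pi *
            (GosperTrig.gosperPiSqrt τ ^ 3 / GosperTrig.gosperPiSqrt (3 * τ))) ∧
      (a ≡ 3 [ZMOD 12] ∨ a ≡ -3 [ZMOD 12] →
        GosperTrig.cotQ (3 * τ) (a * Real.pi / 6) = 0)) := by
  have h2τ : 0 < (2 * τ).im := by simpa using hτ
  have h3τ : 0 < (3 * τ).im := by simpa using hτ
  have n4 := GosperTrig.sinQ_ne_zero h2τ (w := 1 / 4) (by norm_num) (by norm_num)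
  have n6 := GosperTrig.sinQ_ne_zero h3τ (w := 1 / 6) (by norm_num) (by norm_num)
  have n2 := GosperTrig.sinQ_ne_zero h3τ (w := 1 / 2) (by norm_num) (by norm_num)
  refine ⟨⟨GosperTrig.differentiable_sinQ h2τ _, ?_⟩, ⟨GosperTrig.differentiable_sinQ h3τ _, ?_⟩⟩
  · rcases GosperTrig.odd_pi_div_four a ha with ⟨hm, k, hk⟩ | ⟨hm, k, hk⟩
    · rw [hk, GosperTrig.cotQ_add_int_mul_pi h2τ, GosperTrig.cotQ_pi_div_four hτ]
      refine ⟨GosperTrig.sinQ_add_int_mul_pi_ne_zero h2τ k n4, fun _ => rfl, fun h => ?_⟩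
      simp only [Int.ModEq] at hm h
      omega
    · rw [hk, GosperTrig.cotQ_neg_add_int_mul_pi h2τ, GosperTrig.cotQ_pi_div_four hτ, neg_neg]
      refine ⟨GosperTrig.sinQ_neg_add_int_mul_pi_ne_zero h2τ k n4, fun h => ?_, fun _ => rfl⟩
      simp only [Int.ModEq] at hm h
      omega
  · rcases GosperTrig.odd_pi_div_six a ha with ⟨hm, k, hk⟩ | ⟨hm, k, hk⟩ | ⟨hm, k, hk⟩
    · rw [hk, GosperTrig.cotQ_add_int_mul_pi h3τ, GosperTrig.cotQ_pi_div_six hτ]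
      refine ⟨GosperTrig.sinQ_add_int_mul_pi_ne_zero h3τ k n6, fun _ => rfl, fun h => ?_,
        fun h => ?_⟩ <;>
      · simp only [Int.ModEq] at hm h
        omega
    · rw [hk, GosperTrig.cotQ_neg_add_int_mul_pi h3τ, GosperTrig.cotQ_pi_div_six hτ, neg_neg]
      refine ⟨GosperTrig.sinQ_neg_add_int_mul_pi_ne_zero h3τ k n6, fun h => ?_, fun _ => rfl,
        fun h => ?_⟩ <;>
      · simp only [Int.ModEq] at hm h
        omega
    · rw [hk, GosperTrig.cotQ_add_int_mul_pi h3τ, GosperTrig.cotQ_pi_div_two h3τ]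
      refine ⟨GosperTrig.sinQ_add_int_mul_pi_ne_zero h3τ k n2, fun h => ?_, fun h => ?_,
        fun _ => rfl⟩ <;>
      · simp only [Int.ModEq] at hm h
        omega
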